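/- Let $(X,m)$ be a non-atomic probability space (every measurable set of positive measure contains a measurable subset of strictly smaller positive measure), let $\tau$ be an ergodic measure-preserving transformation of $(X,m)$, and for $n\ge 1$ and $f\in L^1(X,m)$ (real or complex scalars) put $M_nf=\frac1n\sum_{j=1}^{n}f\circ\tau^{j}$. Then for any sequence $(n_k)_{k\ge1}$ of positive integers with $n_k\to\infty$ there is $f\in L^1(X,m)$ such that $$\sup_{M\ge 1}\ \sup_{|c_k|\le 1}\Bigl\|\sum_{k=1}^{M}c_k\bigl(M_{n_{k+1}}f-M_{n_k}f\bigr)\Bigr\|_1=\infty ,$$ where the inner supremum is over all scalar sequences $(c_k)$ with $|c_k|\le1$ for all $k$. Moreover, for this $f$, the series $\sum_{k=1}^{\infty}(M_{n_{k+1}}f-M_{n_k}f)$ is not weakly unconditionally convergent in $L^1(X,m)$; that is, there are a continuous linear functional $\varphi$ on $L^1(X,m)$ and a permutation $\pi$ of $\{1,2,3,\dots\}$ such that the scalar series $\sum_{k=1}^{\infty}\varphi\bigl(M_{n_{\pi(k)+1}}f-M_{n_{\pi(k)}}f\bigr)$ diverges. -/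

import Mathlib

open MeasureTheory Filter Topology
open scoped ENNReal

/-- A measure is non-atomic if every measurable set of positive measure contains a measurable
subset of strictly smaller positive measure. (This is not `MeasureTheory.NullSingletonClass`, which only
says that points are null and is strictly weaker on a general measurable space.) -/
def NonAtomicMeasure {X : Type*} [MeasurableSpace X] (m : Measure X) : Prop :=
  ∀ s : Set X, MeasurableSet s → 0 < m s →
    ∃ t : Set X, t ⊆ s ∧ MeasurableSet t ∧ 0 < m t ∧ m t < m s

/-- The ergodic average `M_n f = (1/n) ∑_{j=1}^{n} f ∘ τ^j`, as an operator on `L¹(X, m)`. -/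
noncomputable def ergodicAverage {X : Type*} [MeasurableSpace X] {m : Measure X}
    (𝕜 : Type*) [RCLike 𝕜] {τ : X → X} (hτ : MeasurePreserving τ m m) (n : ℕ)
    (f : Lp 𝕜 1 m) : Lp 𝕜 1 m :=
  (n : 𝕜)⁻¹ • ∑ j ∈ Finset.Icc 1 n, Lp.compMeasurePreserving (τ^[j]) (hτ.iterate j) f

/-- A series `∑ u k` is unconditionally convergent if every rearrangement of it converges
(in the sense that its partial sums converge). -/
def UnconditionallyConvergent {E : Type*} [AddCommMonoid E] [TopologicalSpace E]
    (u : ℕ → E) : Prop :=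
  ∀ π : Equiv.Perm ℕ, ∃ s : E,
    Tendsto (fun M : ℕ => ∑ k ∈ Finset.range M, u (π k)) atTop (𝓝 s)

/-- A series `∑ u k` in a normed space over `𝕜` is weakly unconditionally convergent if the scalar
series `∑ φ (u k)` is unconditionally convergent for every continuous linear functional `φ`. -/
def WeaklyUnconditionallyConvergent (𝕜 : Type*) [RCLike 𝕜] {E : Type*} [NormedAddCommGroup E]
    [NormedSpace 𝕜 E] (u : ℕ → E) : Prop :=
  ∀ φ : E →L[𝕜] 𝕜, UnconditionallyConvergent (fun k => φ (u k))

/-! If every `f` had a finite supremum, Banach–Steinhaus would bound the operators `∑ c_k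
(M_{n_{k+1}} - M_{n_k})` uniformly; so it suffices to find, for each `J`, some `f ≠ 0` and
coefficients expanding its norm by a factor `J`. Take `f` to be the indicator of a set `E` whose
preimages under the first iterates are disjoint. A contractive functional with weight `s i` on the
`i`-th preimage sends `M_l f` to `m E` times the average of `s 1, ..., s l`. Signs constant on
lacunary blocks give these averages infinite variation along `n`, and the `c_k` are the signs of the
increments. Failure of weak unconditional convergence follows because such convergence would bound
the sums with coefficients in the unit ball. -/

theorem NonAtomicMeasure.exists_measure_le {X : Type*} [MeasurableSpace X] {m : Measure X}
    [IsProbabilityMeasure m] (hm : NonAtomicMeasure m) (k : ℕ) :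
    ∃ A : Set X, MeasurableSet A ∧ 0 < m A ∧ 2 ^ k * m A ≤ 1 := by
  induction k with
  | zero => exact ⟨Set.univ, MeasurableSet.univ, by simp, by simp⟩
  | succ k ih =>
    obtain ⟨A, hA, hpos, hle⟩ := ih
    obtain ⟨t, htA, ht, ht0, htlt⟩ := hm A hA hpos
    have hsum : m t + m (A \ t) = m A := by
      rw [measure_sdiff htA ht.nullMeasurableSet (measure_ne_top m t)]
      exact add_tsub_cancel_of_le (measure_mono htA)
    have hdiff : 0 < m (A \ t) := by
      rw [pos_iff_ne_zero]
      intro h0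
      rw [h0, add_zero] at hsum
      exact htlt.ne hsum
    -- The smaller of the two pieces has at most half the measure of `A`.
    rcases le_total (m t) (m (A \ t)) with h | h
    · refine ⟨t, ht, ht0, le_trans ?_ hle⟩
      rw [pow_succ, mul_assoc, two_mul, ← hsum]
      gcongr
    · refine ⟨A \ t, hA.diff ht, hdiff, le_trans ?_ hle⟩
      rw [pow_succ, mul_assoc, two_mul, ← hsum]
      gcongr

/-- For an ergodic transformation of a non-atomic probability space there are sets of positive
measure whose first `L` preimages are pairwise disjoint. -/
theorem Ergodic.exists_disjoint_preimages {X : Type*} [MeasurableSpace X] {m : Measure X}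
    [IsProbabilityMeasure m] (hm : NonAtomicMeasure m) {τ : X → X} (hτ : Ergodic τ m) (L : ℕ) :
    ∃ E : Set X, MeasurableSet E ∧ 0 < m E ∧
      ∀ i j, i < j → j ≤ L → Disjoint (τ^[i] ⁻¹' E) (τ^[j] ⁻¹' E) := by
  obtain ⟨A, hA, hA0, hA1⟩ := hm.exists_measure_le L
  -- `F k` is the set of points whose first visit to `A` is at time `k`.
  let F : ℕ → Set X := fun k => τ^[k] ⁻¹' A ∩ ⋂ i ∈ Finset.range k, (τ^[i] ⁻¹' A)ᶜ
  have hF : ∀ k x, x ∈ F k ↔ τ^[k] x ∈ A ∧ ∀ i < k, τ^[i] x ∉ A := by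
    intro k x; simp [F]
  have hpre : ∀ k, MeasurableSet (τ^[k] ⁻¹' A) := fun k => (hτ.measurable.iterate k) hA
  have hFm : ∀ k, MeasurableSet (F k) := fun k =>
    (hpre k).inter (Finset.measurableSet_biInter _ fun i _ => (hpre i).compl)
  refine ⟨F L, hFm L, ?_, ?_⟩
  · rw [pos_iff_ne_zero]
    intro h0
    -- If `F L` were null, so would be all later `F k`. By ergodicity `F 0, ..., F (L - 1)` would
    -- then cover almost everything, giving `1 ≤ L * m A < 2 ^ L * m A ≤ 1`.
    have hnull : ∀ k, L ≤ k → m (F k) = 0 := by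
      intro k hk
      induction k, hk using Nat.le_induction with
      | base => exact h0
      | succ k hk ih =>
        refine measure_mono_null (t := τ ⁻¹' F k) ?_ ?_
        · intro x hx
          rw [hF] at hx
          rw [Set.mem_preimage, hF]
          exact ⟨hx.1, fun i hi => hx.2 (i + 1) (by omega)⟩
        · rw [hτ.measure_preimage (hFm k).nullMeasurableSet, ih]
    let U : Set X := ⋃ k, τ^[k] ⁻¹' A
    have hU : MeasurableSet U := MeasurableSet.iUnion hpre
    have hsub : τ ⁻¹' U ⊆ U := by
      intro x hx
      obtain ⟨k, hk⟩ := Set.mem_iUnion.1 hx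
      exact Set.mem_iUnion.2 ⟨k + 1, hk⟩
    have hAU : A ⊆ U := fun x hx => Set.mem_iUnion.2 ⟨0, hx⟩
    have hU1 : m U = 1 := by
      rcases hτ.ae_empty_or_univ_of_preimage_ae_le hU.nullMeasurableSet
        hsub.eventuallyLE with h | h
      · rw [ae_eq_empty] at h
        exact absurd (measure_mono_null hAU h) hA0.ne'
      · rw [measure_congr h, measure_univ]
    have hUF : U ⊆ ⋃ k, F k := by
      classical
      intro x hx
      have hex : ∃ k, τ^[k] x ∈ A := Set.mem_iUnion.1 hx
      refine Set.mem_iUnion.2 ⟨Nat.find hex, (hF _ _).2 ⟨Nat.find_spec hex, fun i hi => ?_⟩⟩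
      exact Nat.find_min hex hi
    have hle : m U ≤ L * m A := by
      calc m U ≤ ∑' k, m (F k) := (measure_mono hUF).trans (measure_iUnion_le _)
        _ = ∑ k ∈ Finset.range L, m (F k) :=
          tsum_eq_sum fun k hk => hnull k (by simpa using hk)
        _ ≤ ∑ k ∈ Finset.range L, m A := by
          refine Finset.sum_le_sum fun k _ => (measure_mono Set.inter_subset_left).trans_eq ?_
          exact (hτ.toMeasurePreserving.iterate k).measure_preimage hA.nullMeasurableSet
        _ = L * m A := by simp
    have hlt : (L : ℝ≥0∞) * m A < 2 ^ L * m A := by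
      refine ENNReal.mul_lt_mul_left hA0.ne' (measure_ne_top m A) ?_
      exact_mod_cast Nat.lt_two_pow_self
    rw [hU1] at hle
    exact absurd (hle.trans_lt hlt) (not_lt.2 hA1)
  · intro i j hij hj
    rw [Set.disjoint_left]
    intro x hx hx'
    rw [Set.mem_preimage, hF] at hx hx'
    -- The visit to `A` at time `L + i` precedes the supposed first visit of `τ^[j] x`, at time `L +
    -- j`.
    refine hx'.2 (L - (j - i)) (by omega) ?_
    rw [← Function.iterate_add_apply, show L - (j - i) + j = L + i by omega,
      Function.iterate_add_apply]
    exact hx.1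

/-! ### Unconditional convergence and bounded multipliers -/

/-- If every rearrangement of a series in a Banach space converges, then the series is summable. -/
theorem UnconditionallyConvergent.summable {E : Type*} [NormedAddCommGroup E] [CompleteSpace E]
    {u : ℕ → E} (h : UnconditionallyConvergent u) : Summable u := by
  classical
  by_contra hu
  rw [summable_iff_vanishing_norm] at hu
  push Not at hu
  obtain ⟨ε, hε, ht⟩ := hu
  choose t htd htε using ht
  -- Each stage appends a fresh finite set whose sum has norm at least `ε`, then `k` if still
  -- missing, so that the limiting enumeration is a permutation.
  let L : ℕ → List ℕ := fun k => Nat.rec [] (fun k l =>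
    if k ∈ l ++ (t l.toFinset).toList then l ++ (t l.toFinset).toList
    else l ++ (t l.toFinset).toList ++ [k]) k
  have hL : ∀ k, L (k + 1) = if k ∈ L k ++ (t (L k).toFinset).toList
      then L k ++ (t (L k).toFinset).toList
      else L k ++ (t (L k).toFinset).toList ++ [k] := fun k => rfl
  have hpre : ∀ k, L k ++ (t (L k).toFinset).toList <+: L (k + 1) := by
    intro k
    rw [hL]
    split_ifs
    · exact List.prefix_rfl
    · exact List.prefix_append _ _
  have hstep : ∀ k, L k <+: L (k + 1) := fun k => (List.prefix_append _ _).trans (hpre k)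
  have hmono : ∀ j k, j ≤ k → L j <+: L k := by
    intro j k hjk
    induction k, hjk using Nat.le_induction with
    | base => exact List.prefix_rfl
    | succ k _ ih => exact ih.trans (hstep k)
  have hmem : ∀ k, k ∈ L (k + 1) := by
    intro k
    rw [hL]
    split_ifs with hk
    · exact hk
    · simp
  have hnodup : ∀ k, (L k).Nodup := by
    intro k
    induction k with
    | zero => exact List.nodup_nil
    | succ k ih =>
      have h1 : (L k ++ (t (L k).toFinset).toList).Nodup := by
        refine List.Nodup.append ih (Finset.nodup_toList _) ?_
        intro a ha ha'
        exact Finset.disjoint_left.1 (htd (L k).toFinset) (Finset.mem_toList.1 ha')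
          (List.mem_toFinset.2 ha)
      rw [hL]
      split_ifs with hk
      · exact h1
      · refine List.Nodup.append h1 (List.nodup_singleton k) ?_
        intro a ha ha'
        rw [List.mem_singleton] at ha'
        exact hk (ha' ▸ ha)
  have hlen : ∀ k, k ≤ (L k).length := by
    intro k
    induction k with
    | zero => exact Nat.zero_le _
    | succ k ih =>
      have hne : 0 < (t (L k).toFinset).card := by
        rw [Finset.card_pos, Finset.nonempty_iff_ne_empty]
        intro h0
        have := htε (L k).toFinset
        rw [h0, Finset.sum_empty, norm_zero] at this
        linarith
      have := (hpre k).length_le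
      rw [List.length_append, Finset.length_toList] at this
      omega
  let g : ℕ → ℕ := fun i => (L (i + 1))[i]'(hlen (i + 1))
  have hg : ∀ k i (hi : i < (L k).length), (L k)[i] = g i := by
    intro k i hi
    rcases le_total k (i + 1) with hk | hk
    · exact (hmono _ _ hk).getElem hi
    · exact ((hmono _ _ hk).getElem (hlen (i + 1))).symm
  have hgl : ∀ k l, l <+: L k → l = (List.range l.length).map g := by
    intro k l hl
    refine List.ext_getElem (by simp) fun i h1 h2 => ?_
    rw [hl.getElem h1, hg]
    simp
  have hginj : Function.Injective g := by
    intro i j hij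
    have hi : i < (L (i + j + 1)).length := by have := hlen (i + j + 1); omega
    have hj : j < (L (i + j + 1)).length := by have := hlen (i + j + 1); omega
    rw [← hg (i + j + 1) i hi, ← hg (i + j + 1) j hj] at hij
    exact (hnodup (i + j + 1)).getElem_inj_iff.1 hij
  have hgsurj : Function.Surjective g := by
    intro k
    obtain ⟨i, hi, hik⟩ := List.getElem_of_mem (hmem k)
    exact ⟨i, by rw [← hg (k + 1) i hi, hik]⟩
  have hsum : ∀ k l, l <+: L k →
      ∑ i ∈ Finset.range l.length, u (g i) = (l.map u).sum := by
    intro k l hl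
    conv_rhs => rw [hgl k l hl]
    rw [List.map_map, Finset.sum_range, ← List.sum_ofFn, List.ofFn_eq_map,
      ← List.map_coe_finRange_eq_range, List.map_map]
    rfl
  obtain ⟨s, hs⟩ := h (Equiv.ofBijective g ⟨hginj, hgsurj⟩)
  obtain ⟨N, hN⟩ := Metric.cauchySeq_iff.1 hs.cauchySeq ε hε
  -- The partial sums just before and just after the block added at stage `N` differ by at least
  -- `ε`.
  have h1 := hN (L N ++ (t (L N).toFinset).toList).length
    ((hlen N).trans (by simp)) (L N).length (hlen N)
  change dist (∑ i ∈ Finset.range _, u (g i)) (∑ i ∈ Finset.range _, u (g i)) < ε at h1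
  rw [hsum (N + 1) _ (hpre N), hsum N _ List.prefix_rfl, dist_eq_norm, List.map_append, List.sum_append,
    add_sub_cancel_left, Finset.sum_map_toList] at h1
  exact absurd h1 (not_lt.2 (htε _))

/-- For a series which is weakly unconditionally convergent, the sums with coefficients in the
unit ball are bounded. -/
theorem WeaklyUnconditionallyConvergent.exists_norm_sum_smul_le {𝕜 : Type*} [RCLike 𝕜]
    {E : Type*} [NormedAddCommGroup E] [NormedSpace 𝕜 E] {u : ℕ → E}
    (h : WeaklyUnconditionallyConvergent 𝕜 u) :
    ∃ C : ℝ, ∀ (M : ℕ) (c : ℕ → 𝕜), (∀ k, ‖c k‖ ≤ 1) →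
      ‖∑ k ∈ Finset.range M, c k • u k‖ ≤ C := by
  -- Passing to the bidual makes the domain the dual space, which is complete even if `E` is not.
  let T : ℕ × {c : ℕ → 𝕜 // ∀ k, ‖c k‖ ≤ 1} → StrongDual 𝕜 (StrongDual 𝕜 E) := fun p =>
    NormedSpace.inclusionInDoubleDual 𝕜 E (∑ k ∈ Finset.range p.1, p.2.1 k • u k)
  obtain ⟨C, hC⟩ := banach_steinhaus (g := T) (by
    intro φ
    have hs : Summable fun k => ‖φ (u k)‖ := (h φ).summable.norm
    refine ⟨∑' k, ‖φ (u k)‖, fun p => ?_⟩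
    change ‖φ (∑ k ∈ Finset.range p.1, p.2.1 k • u k)‖ ≤ _
    simp only [map_sum, map_smul]
    refine (norm_sum_le _ _).trans
      (le_trans (Finset.sum_le_sum fun k _ => ?_) (hs.sum_le_tsum _ fun k _ => norm_nonneg _))
    rw [norm_smul]
    exact mul_le_of_le_one_left (norm_nonneg _) (p.2.2 k))
  refine ⟨C, fun M c hc => ?_⟩
  have := hC (M, ⟨c, hc⟩)
  rwa [show ‖T (M, ⟨c, hc⟩)‖ = ‖∑ k ∈ Finset.range M, c k • u k‖ from
    (NormedSpace.inclusionInDoubleDualLi 𝕜).norm_map _] at this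

/-! ### Oscillating scalar averages -/

/-- Averages of a suitable sequence of signs oscillate along a given lacunary sequence. -/
theorem exists_oscillating_averages (N : ℕ → ℕ) (h0 : ∀ j, 0 < N j)
    (hN : ∀ j, 4 * N j ≤ N (j + 1)) :
    ∃ s : ℕ → ℝ, (∀ i, |s i| ≤ 1) ∧ ∀ j,
      1 ≤ |(N (j + 2) : ℝ)⁻¹ * ∑ i ∈ Finset.Icc 1 (N (j + 2)), s i
        - (N (j + 1) : ℝ)⁻¹ * ∑ i ∈ Finset.Icc 1 (N (j + 1)), s i| := by
  classical
  have hmono : Monotone N := monotone_nat_of_le_succ fun j => by have := hN j; omega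
  -- The sign alternates between consecutive blocks `(N j, N (j + 1)]`; the default `1` is never
  -- reached, since `N` is unbounded.
  let s : ℕ → ℝ := fun i => if h : ∃ j, i ≤ N j then (-1) ^ Nat.find h else 1
  have hs : ∀ i, |s i| ≤ 1 := by
    intro i
    simp only [s]
    split_ifs <;> simp
  have hblock : ∀ j, ∀ i ∈ Finset.Ioc (N j) (N (j + 1)), s i = (-1) ^ (j + 1) := by
    intro j i hi
    rw [Finset.mem_Ioc] at hi
    have hex : ∃ j, i ≤ N j := ⟨j + 1, hi.2⟩
    have hfind : Nat.find hex = j + 1 := by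
      rw [Nat.find_eq_iff]
      refine ⟨hi.2, fun l hl hil => ?_⟩
      have := hmono (Nat.lt_succ_iff.1 hl)
      omega
    simp only [s, dif_pos hex, hfind]
  -- The terms up to `N j` shift the average by at most `2 * N j / N (j + 1) ≤ 1 / 2`. Consecutive
  -- targets `±1` are `2` apart, which leaves a gap of at least `1`.
  have hclose : ∀ j,
      |(N (j + 1) : ℝ)⁻¹ * ∑ i ∈ Finset.Icc 1 (N (j + 1)), s i - (-1) ^ (j + 1)| ≤ 1 / 2 := by
    intro j
    have hpos : (0 : ℝ) < N (j + 1) := by exact_mod_cast h0 (j + 1)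
    have h4 : 4 * (N j : ℝ) ≤ N (j + 1) := by exact_mod_cast hN j
    have hle := hmono (Nat.le_succ j)
    have hIcc : ∀ n, Finset.Icc 1 n = Finset.Ioc 0 n := fun n => by ext; simp [Nat.succ_le_iff]
    have hsplit : ∑ i ∈ Finset.Icc 1 (N (j + 1)), s i
        = ∑ i ∈ Finset.Icc 1 (N j), s i + ((N (j + 1) : ℝ) - N j) * (-1) ^ (j + 1) := by
      rw [hIcc, hIcc, ← Finset.sum_Ioc_consecutive _ (Nat.zero_le _) hle,
        Finset.sum_congr rfl (hblock j), Finset.sum_const, Nat.card_Ioc, nsmul_eq_mul,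
        Nat.cast_sub hle]
    have hbound : |∑ i ∈ Finset.Icc 1 (N j), s i| ≤ N j := by
      refine (Finset.abs_sum_le_sum_abs _ _).trans ((Finset.sum_le_sum fun i _ => hs i).trans ?_)
      simp
    have hsign : |(N j : ℝ) * (-1) ^ (j + 1)| = N j := by simp [abs_mul]
    have heq : (N (j + 1) : ℝ)⁻¹ * ∑ i ∈ Finset.Icc 1 (N (j + 1)), s i - (-1) ^ (j + 1)
        = (∑ i ∈ Finset.Icc 1 (N j), s i - N j * (-1) ^ (j + 1)) / N (j + 1) := by
      rw [hsplit]
      field_simp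
      ring
    rw [heq, abs_div, abs_of_pos hpos, div_le_iff₀ hpos]
    have := abs_sub (∑ i ∈ Finset.Icc 1 (N j), s i) (N j * (-1) ^ (j + 1))
    linarith
  refine ⟨s, hs, fun j => ?_⟩
  have h1 := abs_le.1 (hclose j)
  have h2 := abs_le.1 (hclose (j + 1))
  rw [show j + 1 + 1 = j + 2 from rfl] at h2
  rw [pow_succ] at h2
  rcases neg_one_pow_eq_or ℝ (j + 1) with h | h <;> rw [h] at h1 h2
  · rw [le_abs]; right; linarith [h1.1, h2.2]
  · rw [le_abs]; left; linarith [h1.2, h2.1]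

/-- Along any sequence tending to infinity, the averages of some bounded sequence have infinite
variation. -/
theorem exists_averages_infinite_variation (n : ℕ → ℕ) (hn : ∀ k, 0 < n k)
    (hn_top : Tendsto n atTop atTop) :
    ∃ s : ℕ → ℝ, (∀ i, |s i| ≤ 1) ∧ ∀ J : ℕ, ∃ M : ℕ,
      (J : ℝ) ≤ ∑ k ∈ Finset.range M,
        |(n (k + 1) : ℝ)⁻¹ * ∑ i ∈ Finset.Icc 1 (n (k + 1)), s i
          - (n k : ℝ)⁻¹ * ∑ i ∈ Finset.Icc 1 (n k), s i| := by
  have hnext : ∀ k, ∃ l, k ≤ l ∧ 4 * n k ≤ n l := fun k =>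
    ((eventually_ge_atTop k).and (hn_top.eventually_ge_atTop (4 * n k))).exists
  choose next hle h4 using hnext
  let K : ℕ → ℕ := fun j => next^[j] 0
  have hK : ∀ j, K (j + 1) = next (K j) := fun j => Function.iterate_succ_apply' next j 0
  obtain ⟨s, hs, hosc⟩ := exists_oscillating_averages (fun j => n (K j)) (fun j => hn _)
    (fun j => by rw [hK]; exact h4 _)
  refine ⟨s, hs, fun J => ⟨K (J + 1), ?_⟩⟩
  induction J with
  | zero =>
    rw [Nat.cast_zero]
    exact Finset.sum_nonneg fun _ _ => abs_nonneg _
  | succ J ih =>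
    have hJ : K (J + 1) ≤ K (J + 2) := by rw [hK (J + 1)]; exact hle _
    have hdist := dist_le_Ico_sum_dist
      (fun k => (n k : ℝ)⁻¹ * ∑ i ∈ Finset.Icc 1 (n k), s i) hJ
    rw [dist_comm, Real.dist_eq] at hdist
    simp only [fun a b : ℝ => (dist_comm a b).trans (Real.dist_eq b a)] at hdist
    rw [← Finset.sum_range_add_sum_Ico _ hJ, Nat.cast_succ]
    exact add_le_add ih ((hosc J).trans hdist)

/-! ### Transfer to `L¹` and conclusion -/

/-- Prescribed weights of modulus at most one on disjoint sets are realised by a contractive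
linear functional on `L¹`. -/
theorem exists_linearMap_indicatorConstLp (𝕜 : Type*) [RCLike 𝕜] {X ι : Type*} [MeasurableSpace X]
    {m : Measure X} [IsFiniteMeasure m] (t : Finset ι) {F : ι → Set X}
    (hF : ∀ i, MeasurableSet (F i)) (hd : Set.PairwiseDisjoint (↑t) F)
    (s : ι → ℝ) (hs : ∀ i, |s i| ≤ 1) :
    ∃ φ : Lp 𝕜 1 m →ₗ[𝕜] 𝕜, (∀ g, ‖φ g‖ ≤ ‖g‖) ∧
      ∀ i ∈ t, φ (indicatorConstLp 1 (hF i) (measure_ne_top m _) 1)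
        = ((s i * m.real (F i) : ℝ) : 𝕜) := by
  classical
  have hint : ∀ g : Lp 𝕜 1 m, Integrable g m := fun g => L1.integrable_coeFn g
  refine ⟨
    { toFun := fun g => ∑ i ∈ t, (s i : 𝕜) * ∫ x in F i, g x ∂m
      map_add' := fun f g => ?_
      map_smul' := fun c g => ?_ }, fun g => ?_, fun i hi => ?_⟩
  · rw [← Finset.sum_add_distrib]
    refine Finset.sum_congr rfl fun i _ => ?_
    rw [← mul_add, ← integral_add (hint f).integrableOn (hint g).integrableOn]
    congr 1
    exact integral_congr_ae (ae_restrict_of_ae (Lp.coeFn_add f g))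
  · rw [RingHom.id_apply, smul_eq_mul, Finset.mul_sum]
    refine Finset.sum_congr rfl fun i _ => ?_
    rw [mul_left_comm, ← smul_eq_mul c, ← integral_smul]
    congr 1
    exact integral_congr_ae (ae_restrict_of_ae (Lp.coeFn_smul c g))
  · change ‖∑ i ∈ t, (s i : 𝕜) * ∫ x in F i, g x ∂m‖ ≤ ‖g‖
    calc ‖∑ i ∈ t, (s i : 𝕜) * ∫ x in F i, g x ∂m‖
        ≤ ∑ i ∈ t, ∫ x in F i, ‖g x‖ ∂m := by
          refine (norm_sum_le _ _).trans (Finset.sum_le_sum fun i _ => ?_)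
          rw [norm_mul, RCLike.norm_ofReal]
          exact (mul_le_of_le_one_left (norm_nonneg _) (hs i)).trans
            (norm_integral_le_integral_norm _)
      _ = ∫ x in ⋃ i ∈ t, F i, ‖g x‖ ∂m :=
          (integral_biUnion_finset t (fun i _ => hF i) hd
            fun i _ => (hint g).norm.integrableOn).symm
      _ ≤ ∫ x, ‖g x‖ ∂m :=
          setIntegral_le_integral (hint g).norm (Eventually.of_forall fun x => norm_nonneg _)
      _ = ‖g‖ := (L1.norm_eq_integral_norm g).symm
  · change ∑ j ∈ t, (s j : 𝕜) * ∫ x in F j,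
      indicatorConstLp 1 (hF i) (measure_ne_top m _) (1 : 𝕜) x ∂m = _
    rw [Finset.sum_eq_single i]
    · rw [setIntegral_indicatorConstLp (hF i), Set.inter_self, RCLike.real_smul_eq_coe_mul, mul_one,
        RCLike.ofReal_mul]
    · intro j hj hji
      rw [setIntegral_indicatorConstLp (hF j), (hd hi hj hji.symm).inter_eq]
      simp
    · exact fun h => absurd hi h

/-- The ergodic average as a continuous linear operator on `L¹`. -/
noncomputable def ergodicAverageCLM {X : Type*} [MeasurableSpace X] {m : Measure X}
    (𝕜 : Type*) [RCLike 𝕜] {τ : X → X} (hτ : MeasurePreserving τ m m) (n : ℕ) :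
    Lp 𝕜 1 m →L[𝕜] Lp 𝕜 1 m :=
  (n : 𝕜)⁻¹ • ∑ j ∈ Finset.Icc 1 n,
    (Lp.compMeasurePreservingₗᵢ 𝕜 (τ^[j]) (hτ.iterate j)).toContinuousLinearMap

theorem ergodicAverageCLM_apply {X : Type*} [MeasurableSpace X] {m : Measure X}
    (𝕜 : Type*) [RCLike 𝕜] {τ : X → X} (hτ : MeasurePreserving τ m m) (n : ℕ) (f : Lp 𝕜 1 m) :
    ergodicAverageCLM 𝕜 hτ n f = ergodicAverage 𝕜 hτ n f := by
  simp only [ergodicAverageCLM, ergodicAverage, smul_apply,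
    sum_apply]
  rfl

/-- Along any sequence tending to infinity, the ergodic averages of indicators of sets with
disjoint preimages have arbitrarily large variation against a contractive functional. -/
theorem exists_le_norm_sum_smul_ergodicAverage_sub (𝕜 : Type*) [RCLike 𝕜] {X : Type*}
    [MeasurableSpace X] (m : Measure X) [IsProbabilityMeasure m] (hm : NonAtomicMeasure m)
    (τ : X → X) (hτ : Ergodic τ m) (n : ℕ → ℕ) (hn : ∀ k, 0 < n k)
    (hn_top : Tendsto n atTop atTop) (J : ℕ) :
    ∃ (M : ℕ) (c : ℕ → 𝕜) (f : Lp 𝕜 1 m), (∀ k, ‖c k‖ ≤ 1) ∧ f ≠ 0 ∧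
      J * ‖f‖ ≤ ‖∑ k ∈ Finset.range M, c k •
          (ergodicAverage 𝕜 hτ.toMeasurePreserving (n (k + 1)) f
            - ergodicAverage 𝕜 hτ.toMeasurePreserving (n k) f)‖ := by
  obtain ⟨s, hs, hvar⟩ := exists_averages_infinite_variation n hn hn_top
  obtain ⟨M, hM⟩ := hvar J
  -- Only the averages with index at most `M` occur, so finitely many disjoint preimages suffice.
  let L : ℕ := (Finset.range (M + 1)).sup n
  have hL : ∀ k ≤ M, n k ≤ L := fun k hk =>
    Finset.le_sup (f := n) (Finset.mem_range.2 (Nat.lt_succ_of_le hk))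
  obtain ⟨E, hE, hE0, hdis⟩ := hτ.exists_disjoint_preimages hm L
  have hmp : ∀ i, MeasurePreserving (τ^[i]) m m := fun i => hτ.toMeasurePreserving.iterate i
  obtain ⟨φ, hφ, hφi⟩ := exists_linearMap_indicatorConstLp 𝕜 (m := m) (Finset.Icc 1 L)
    (F := fun i => τ^[i] ⁻¹' E) (fun i => (hmp i).measurable hE) (by
      intro i hi j hj hij
      rw [Finset.mem_coe, Finset.mem_Icc] at hi hj
      rcases lt_or_gt_of_ne hij with h | h
      · exact hdis i j h hj.2
      · exact (hdis j i h hi.2).symm) s hs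
  let f : Lp 𝕜 1 m := indicatorConstLp 1 hE (measure_ne_top m _) 1
  let A : ℕ → ℝ := fun l => (l : ℝ)⁻¹ * ∑ i ∈ Finset.Icc 1 l, s i
  have hreal : 0 < m.real E := ENNReal.toReal_pos hE0.ne' (measure_ne_top m E)
  have hf : ‖f‖ = m.real E := by
    simp [f, norm_indicatorConstLp]
  have hφA : ∀ l ≤ L, φ (ergodicAverage 𝕜 hτ.toMeasurePreserving l f)
      = ((A l * m.real E : ℝ) : 𝕜) := by
    intro l hl
    have hterm : ∀ i ∈ Finset.Icc 1 l,
        φ (Lp.compMeasurePreserving (τ^[i]) (hmp i) f) = ((s i * m.real E : ℝ) : 𝕜) := by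
      intro i hi
      rw [Finset.mem_Icc] at hi
      have h := hφi i (Finset.mem_Icc.2 ⟨hi.1, hi.2.trans hl⟩)
      rw [measureReal_def, (hmp i).measure_preimage hE.nullMeasurableSet] at h
      rw [Lp.indicatorConstLp_compMeasurePreserving]
      exact h
    rw [ergodicAverage, map_smul, map_sum, Finset.sum_congr rfl hterm, ← RCLike.ofReal_sum,
      ← Finset.sum_mul, smul_eq_mul]
    simp only [A]
    push_cast
    ring
  let c : ℕ → 𝕜 := fun k => ((SignType.sign (A (n (k + 1)) - A (n k)) : ℝ) : 𝕜)
  have hc : ∀ k, ‖c k‖ ≤ 1 := by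
    intro k
    simp only [c, RCLike.norm_ofReal]
    rcases SignType.sign (A (n (k + 1)) - A (n k)) with _ | _ | _ <;> simp
  refine ⟨M, c, f, hc, fun h => ?_, le_trans ?_ (hφ _)⟩
  · rw [h, norm_zero] at hf
    exact hreal.ne hf
  · have hval : φ (∑ k ∈ Finset.range M, c k •
          (ergodicAverage 𝕜 hτ.toMeasurePreserving (n (k + 1)) f
            - ergodicAverage 𝕜 hτ.toMeasurePreserving (n k) f))
        = (((∑ k ∈ Finset.range M, |A (n (k + 1)) - A (n k)|) * m.real E : ℝ) : 𝕜) := by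
      rw [map_sum, Finset.sum_mul, RCLike.ofReal_sum]
      refine Finset.sum_congr rfl fun k hk => ?_
      rw [Finset.mem_range] at hk
      rw [map_smul, map_sub, hφA _ (hL _ hk), hφA _ (hL _ hk.le), smul_eq_mul,
        ← RCLike.ofReal_sub, ← RCLike.ofReal_mul, ← sub_mul, ← mul_assoc, sign_mul_self]
    rw [hval, RCLike.norm_ofReal, hf]
    exact (mul_le_mul_of_nonneg_right hM hreal.le).trans (le_abs_self _)

theorem theorem2p17 {𝕜 : Type*} [RCLike 𝕜] {X : Type*} [MeasurableSpace X]
    (m : Measure X) [IsProbabilityMeasure m] (hm : NonAtomicMeasure m)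
    (τ : X → X) (hτ : Ergodic τ m)
    (n : ℕ → ℕ) (hn : ∀ k, 0 < n k) (hn_top : Tendsto n atTop atTop) :
    ∃ f : Lp 𝕜 1 m,
      (⨆ (M : ℕ) (c : ℕ → 𝕜) (_ : ∀ k, ‖c k‖ ≤ 1),
        ‖∑ k ∈ Finset.range M, c k •
          (ergodicAverage 𝕜 hτ.toMeasurePreserving (n (k + 1)) f
            - ergodicAverage 𝕜 hτ.toMeasurePreserving (n k) f)‖ₑ) = (⊤ : ℝ≥0∞) ∧
      ¬ WeaklyUnconditionallyConvergent 𝕜 (fun k : ℕ =>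
          ergodicAverage 𝕜 hτ.toMeasurePreserving (n (k + 1)) f
            - ergodicAverage 𝕜 hτ.toMeasurePreserving (n k) f) := by
  let u : Lp 𝕜 1 m → ℕ → Lp 𝕜 1 m := fun f k =>
    ergodicAverage 𝕜 hτ.toMeasurePreserving (n (k + 1)) f
      - ergodicAverage 𝕜 hτ.toMeasurePreserving (n k) f
  let S : Lp 𝕜 1 m → ℝ≥0∞ := fun f =>
    ⨆ (M : ℕ) (c : ℕ → 𝕜) (_ : ∀ k, ‖c k‖ ≤ 1), ‖∑ k ∈ Finset.range M, c k • u f k‖ₑ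
  have hS : ∀ f, S f = ⊤ ↔ ¬ ∃ C : ℝ, ∀ (M : ℕ) (c : ℕ → 𝕜), (∀ k, ‖c k‖ ≤ 1) →
      ‖∑ k ∈ Finset.range M, c k • u f k‖ ≤ C := by
    intro f
    rw [iff_not_comm]
    constructor
    · rintro ⟨C, hC⟩
      refine ne_top_of_le_ne_top (ENNReal.ofReal_ne_top (r := C))
        (iSup_le fun M => iSup_le fun c => iSup_le fun hc => ?_)
      rw [← ofReal_norm]
      exact ENNReal.ofReal_le_ofReal (hC M c hc)
    · intro hf
      refine ⟨(S f).toReal, fun M c hc => ?_⟩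
      rw [← toReal_enorm]
      refine ENNReal.toReal_mono hf ?_
      exact le_iSup_of_le M (le_iSup_of_le c (le_iSup_of_le hc le_rfl))
  suffices h : ∃ f, S f = ⊤ by
    obtain ⟨f, hf⟩ := h
    exact ⟨f, hf, fun hw => (hS f).1 hf hw.exists_norm_sum_smul_le⟩
  by_contra! hfin
  let T : ℕ × {c : ℕ → 𝕜 // ∀ k, ‖c k‖ ≤ 1} → Lp 𝕜 1 m →L[𝕜] Lp 𝕜 1 m := fun p =>
    ∑ k ∈ Finset.range p.1, p.2.1 k • (ergodicAverageCLM 𝕜 hτ.toMeasurePreserving (n (k + 1))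
      - ergodicAverageCLM 𝕜 hτ.toMeasurePreserving (n k))
  have hT : ∀ p f, T p f = ∑ k ∈ Finset.range p.1, p.2.1 k • u f k := by
    intro p f
    simp only [T, u, sum_apply, smul_apply,
      sub_apply, ergodicAverageCLM_apply]
  obtain ⟨C, hC⟩ := banach_steinhaus (g := T) (by
    intro f
    obtain ⟨C, hC⟩ := not_not.1 (mt (hS f).2 (hfin f))
    exact ⟨C, fun p => by rw [hT]; exact hC p.1 p.2.1 p.2.2⟩)
  obtain ⟨J, hJ⟩ := exists_nat_gt C
  obtain ⟨M, c, f, hc, hf, hle⟩ :=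
    exists_le_norm_sum_smul_ergodicAverage_sub 𝕜 m hm τ hτ n hn hn_top J
  have hpos : 0 < ‖f‖ := norm_pos_iff.2 hf
  have h1 : (J : ℝ) * ‖f‖ ≤ C * ‖f‖ := by
    refine hle.trans ?_
    have := (T (M, ⟨c, hc⟩)).le_of_opNorm_le (hC _) f
    rwa [hT] at this
  exact absurd (le_of_mul_le_mul_right h1 hpos) (not_le.2 hJ)
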